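/- A composition is a nonempty finite list $\alpha=(a_1,\dots,a_k)$ of positive integers; its length is $k$ and its reversal is $\alpha^*=(a_k,\dots,a_1)$. It is symmetric if $\alpha=\alpha^*$, and asymmetric otherwise. For compositions $\alpha=(a_1,\dots,a_k)$ and $\beta=(b_1,\dots,b_m)$ let $\alpha\cdot\beta=(a_1,\dots,a_k,b_1,\dots,b_m)$ and $\alpha\odot\beta=(a_1,\dots,a_{k-1},a_k+b_1,b_2,\dots,b_m)$, let $\beta^{\odot n}=\beta\odot\cdots\odot\beta$ ($n\ge 1$ factors), and let $$\alpha\circ\beta=\beta^{\odot a_1}\cdot\beta^{\odot a_2}\cdots\beta^{\odot a_k}.$$ A factorisation $\beta\circ\gamma$ is trivial if one of $\beta,\gamma$ is the composition $(1)$, or $\beta$ and $\gamma$ both have length $1$, or $\beta$ and $\gamma$ both have all components equal to $1$. A factorisation $\alpha=\alpha_1\circ\alpha_2\circ\cdots\circ\alpha_k$ with $k\ge 1$ is irreducible if no $\alpha_i\circ\alpha_{i+1}$ ($1\le i<k$) is a trivial factorisation and each $\alpha_i$ admits only trivial factorisations $\alpha_i=\beta\circ\gamma$. For compositions $\alpha=(a_1,\dots,a_k)$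 and $\beta=(b_1,\dots,b_k)$ of the same length, $\alpha<\beta$ means that there is an $s$ with $a_s<b_s$ and $a_r=b_r$ for all $r<s$. **Lemma.** Let $\alpha$ be a composition with irreducible factorisation $\alpha=\alpha_1\circ\alpha_2\circ\cdots\circ\alpha_k$. Then $\alpha$ is symmetric if and only if all $\alpha_i$, $i\in\{1,\dots,k\}$, are symmetric. If $\alpha$ is asymmetric, then there is an $\ell\in\{1,\dots,k\}$ such that $\alpha_\ell$ is asymmetric and $\alpha_i$ is symmetric for all $i>\ell$. For this $\ell$, $\alpha<\alpha^*$ if and only if $\alpha_\ell<\alpha_\ell^*$. -/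

import Mathlib

/-- A composition of some positive integer: a (nonempty) list of positive integers, bundled
with its size, the sum of the list. -/
structure Comp where
  /-- the size, i.e. the positive integer that is composed -/
  size : ℕ
  size_pos : 0 < size
  /-- the underlying composition of `size` -/
  toComposition : Composition size

namespace Comp

/-- The list of components `(a₁, …, a_k)`. -/
def blocks (α : Comp) : List ℕ := α.toComposition.blocks

/-- The length `l(α)`, i.e. the number of components. -/
def length (α : Comp) : ℕ := α.blocks.length

theorem blocks_pos (α : Comp) : ∀ a ∈ α.blocks, 0 < a :=
  fun _ h => α.toComposition.blocks_pos h

theorem blocks_sum (α : Comp) : α.blocks.sum = α.size := α.toComposition.blocks_sum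

theorem blocks_ne_nil (α : Comp) : α.blocks ≠ [] := by
  intro h
  have h1 := α.blocks_sum
  have h2 := α.size_pos
  rw [h] at h1
  simp at h1
  omega

@[ext]
theorem ext {α β : Comp} (h : α.blocks = β.blocks) : α = β := by
  obtain ⟨m, hm, a⟩ := α
  obtain ⟨n, hn, b⟩ := β
  have e : (⟨m, a⟩ : Σ n, Composition n) = ⟨n, b⟩ :=
    Composition.sigma_eq_iff_blocks_eq.2 h
  cases e
  rfl

/-- The composition whose components are the entries of a nonempty list of positive integers. -/
def ofBlocks (l : List ℕ) (hne : l ≠ []) (hpos : ∀ a ∈ l, 0 < a) : Comp where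
  size := l.sum
  size_pos := by
    obtain ⟨a, l, rfl⟩ := List.exists_cons_of_ne_nil hne
    have := hpos a (by simp)
    simp only [List.sum_cons]
    omega
  toComposition := ⟨l, fun h => hpos _ h, rfl⟩

@[simp]
theorem blocks_ofBlocks (l : List ℕ) (hne : l ≠ []) (hpos : ∀ a ∈ l, 0 < a) :
    (ofBlocks l hne hpos).blocks = l := rfl

/-- The composition `(1)`. -/
def one : Comp := ofBlocks [1] (by simp) (by simp)

/-- The reversal `α^* = (a_k, …, a₁)`. -/
def reversal (α : Comp) : Comp := ⟨α.size, α.size_pos, α.toComposition.reverse⟩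

@[simp]
theorem blocks_reversal (α : Comp) : α.reversal.blocks = α.blocks.reverse := rfl

/-- A composition is symmetric if it coincides with its reversal. -/
def IsSymmetric (α : Comp) : Prop := α = α.reversal

/-- Near concatenation `α ⊙ β = (a₁, …, a_k + b₁, …, b_ℓ)`. -/
def near (α β : Comp) : Comp :=
  ofBlocks
    (α.blocks.dropLast ++
      (α.blocks.getLast α.blocks_ne_nil + β.blocks.head β.blocks_ne_nil) :: β.blocks.tail)
    (by simp)
    (by
      intro a h
      rcases List.mem_append.1 h with h | h
      · exact α.blocks_pos a (List.mem_of_mem_dropLast h)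
      · rcases List.mem_cons.1 h with h | h
        · have := α.blocks_pos _ (List.getLast_mem α.blocks_ne_nil)
          omega
        · exact β.blocks_pos a (List.mem_of_mem_tail h))

/-- `nearPow α n` is `α^{⊙n} = α ⊙ ⋯ ⊙ α` (`n` factors) for `n ≥ 1`; the value at `n = 0` is
never used. -/
def nearPow (α : Comp) : ℕ → Comp
  | 0 => α
  | 1 => α
  | n + 2 => near (nearPow α (n + 1)) α

/-- The composition `α ∘ β`: the concatenation `β^{⊙a₁} · β^{⊙a₂} ⋯ β^{⊙a_k}`, where
`α = (a₁, …, a_k)`. -/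
def circ (α β : Comp) : Comp :=
  ofBlocks (α.blocks.flatMap fun a => (nearPow β a).blocks)
    (by
      obtain ⟨a, l, h⟩ := List.exists_cons_of_ne_nil α.blocks_ne_nil
      simp [h, blocks_ne_nil])
    (by
      intro b h
      obtain ⟨a, -, hb⟩ := List.mem_flatMap.1 h
      exact blocks_pos _ b hb)

/-- The iterated composition `α₁ ∘ (α₂ ∘ (⋯ ∘ α_k))` of a list `[α₁, …, α_k]`
(only used for `k ≥ 1`). -/
def circList : List Comp → Comp
  | [] => one
  | [α] => α
  | α :: β :: L => circ α (circList (β :: L))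

/-- The factorisation `β ∘ γ` is trivial. -/
def IsTrivialFactorisation (β γ : Comp) : Prop :=
  (β = one ∨ γ = one) ∨
  (β.length = 1 ∧ γ.length = 1) ∨
  ((∀ b ∈ β.blocks, b = 1) ∧ (∀ c ∈ γ.blocks, c = 1))

/-- All factorisations of `α` into two factors are trivial. -/
def AdmitsOnlyTrivialFactorisations (α : Comp) : Prop :=
  ∀ β γ : Comp, α = circ β γ → IsTrivialFactorisation β γ

/-- `α = α₁ ∘ ⋯ ∘ α_k` (with `L = [α₁, …, α_k]`, `k ≥ 1`) is an irreducible factorisation of `α`: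
no `α_i ∘ α_{i+1}` is a trivial factorisation and each `α_i` admits only trivial
factorisations. -/
structure IsIrreducibleFactorisation (α : Comp) (L : List Comp) : Prop where
  ne_nil : L ≠ []
  eq_circList : α = circList L
  not_trivial : ∀ (i : ℕ) (h : i + 1 < L.length), ¬ IsTrivialFactorisation L[i] L[i + 1]
  only_trivial : ∀ β ∈ L, AdmitsOnlyTrivialFactorisations β

/-- Lexicographic order on compositions of the same length: `a_s < b_s` for some `s` such that
`a_r = b_r` for all `r < s`. -/
def LexLT (α β : Comp) : Prop :=
  α.length = β.length ∧
    ∃ (s : ℕ) (hα : s < α.blocks.length) (hβ : s < β.blocks.length),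
      α.blocks[s] < β.blocks[s] ∧
      ∀ (r : ℕ) (hr : r < s), α.blocks[r] = β.blocks[r]

end Comp

namespace Comp

/-! Reversal distributes over `∘` (`reversal_circ`), so `α ∘ β` is to be compared with `α* ∘ β*`. If
`β` is asymmetric, then `β` and `β*` have the same sum, so they first differ before their last
component. Gluing copies leaves that component untouched, so the difference already shows in the
first copy of `β`, whatever the left factor is (`circ_lt_circ_of_right`). If `β = β*`, the first
difference between `α` and `α*` decides, since a larger `⊙`-power of `β` is lexicographically larger
at the relevant place (`circ_lt_circ_of_left`). Hence the rightmost asymmetric factor decides the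
comparison. -/

theorem exists_blocks_eq_concat (α : Comp) : ∃ p x, α.blocks = p ++ [x] :=
  ⟨_, _, (List.dropLast_append_getLast α.blocks_ne_nil).symm⟩

theorem exists_blocks_eq_cons (α : Comp) : ∃ x p, α.blocks = x :: p :=
  List.exists_cons_of_ne_nil α.blocks_ne_nil

theorem blocks_near {α β : Comp} {p q : List ℕ} {x y : ℕ} (hα : α.blocks = p ++ [x])
    (hβ : β.blocks = y :: q) : (near α β).blocks = p ++ (x + y) :: q := by
  simp [near, hα, hβ]

theorem near_assoc (α β γ : Comp) : near (near α β) γ = near α (near β γ) := by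
  obtain ⟨p, x, hα⟩ := α.exists_blocks_eq_concat
  obtain ⟨y, m, hβ⟩ := β.exists_blocks_eq_cons
  obtain ⟨z, q, hγ⟩ := γ.exists_blocks_eq_cons
  apply Comp.ext
  -- If `β` has a single component, both gluings act on that same component.
  rcases List.eq_nil_or_concat m with rfl | ⟨m, w, rfl⟩
  · rw [blocks_near (blocks_near hα hβ) hγ,
      blocks_near hα (blocks_near (p := []) (by simpa using hβ) hγ), Nat.add_assoc]
  · rw [List.concat_eq_append] at hβ
    rw [blocks_near (p := p ++ (x + y) :: m) (x := w) (by simp [blocks_near hα hβ]) hγ,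
      blocks_near (y := y) (q := m ++ (w + z) :: q) hα
        (by simp [blocks_near (α := β) (p := y :: m) (x := w) (by simpa using hβ) hγ])]
    simp

theorem reversal_near (α β : Comp) : (near α β).reversal = near β.reversal α.reversal := by
  obtain ⟨p, x, hα⟩ := α.exists_blocks_eq_concat
  obtain ⟨y, q, hβ⟩ := β.exists_blocks_eq_cons
  apply Comp.ext
  rw [blocks_near (p := q.reverse) (x := y) (y := x) (q := p.reverse) (by simp [hβ])
    (by simp [hα]), blocks_reversal, blocks_near hα hβ]
  simp [Nat.add_comm]

/-- Reversal moves the factor appended by `nearPow` to the front; this moves it back. -/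
theorem near_nearPow_comm (α : Comp) (n : ℕ) :
    near α (nearPow α n) = near (nearPow α n) α := by
  induction n using nearPow.induct with
  | case1 => rfl
  | case2 => rfl
  | case3 n ih => rw [nearPow, ← near_assoc, ih]

theorem reversal_nearPow (α : Comp) (n : ℕ) :
    (nearPow α n).reversal = nearPow α.reversal n := by
  induction n using nearPow.induct with
  | case1 => rfl
  | case2 => rfl
  | case3 n ih => rw [nearPow, nearPow, reversal_near, ih, near_nearPow_comm]

theorem reversal_circ (α β : Comp) :
    (circ α β).reversal = circ α.reversal β.reversal := by
  apply Comp.ext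
  simp only [circ, blocks_reversal, blocks_ofBlocks, List.reverse_flatMap]
  congr 1
  funext a
  rw [← reversal_nearPow]
  rfl

theorem append_cons_lt_append_cons (p x y : List ℕ) {a b : ℕ} (h : a < b) :
    p ++ a :: x < p ++ b :: y := by
  induction p with
  | nil => exact List.Lex.rel h
  | cons c p ih => exact List.Lex.cons ih

theorem exists_of_lt {l l' : List ℕ} (hl : l.length = l'.length) (h : l < l') :
    ∃ p a b x y, l = p ++ a :: x ∧ l' = p ++ b :: y ∧ a < b := by
  induction h with
  | nil => simp at hl
  | rel h => exact ⟨[], _, _, _, _, rfl, rfl, h⟩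
  | cons _ ih =>
    obtain ⟨p, a, b, x, y, rfl, rfl, h⟩ := ih (by simpa using hl)
    exact ⟨_ :: p, a, b, x, y, rfl, rfl, h⟩

theorem lexLT_iff {α β : Comp} (h : α.length = β.length) :
    LexLT α β ↔ α.blocks < β.blocks := by
  rw [List.lt_iff_exists]
  have hne : ¬ α.blocks.length < β.blocks.length := fun h' => h'.ne h
  simp only [hne, and_false, false_or, LexLT, h, true_and]
  constructor
  · rintro ⟨s, h1, h2, h3, h4⟩
    exact ⟨s, h1, h2, h4, h3⟩
  · rintro ⟨s, h1, h2, h3, h4⟩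
    exact ⟨s, h1, h2, h4, h3⟩

/-- A larger power `α^{⊙b}` agrees with `α^{⊙a}` except that the last component of the latter is
enlarged and possibly followed by further components. -/
theorem nearPow_blocks_of_lt (α : Comp) {a b : ℕ} (ha : 0 < a) (hab : a < b) :
    ∃ p x y z, (nearPow α a).blocks = p ++ [x] ∧ (nearPow α b).blocks = p ++ y :: z ∧ x < y := by
  obtain ⟨c, q, hα⟩ := α.exists_blocks_eq_cons
  have hc : 0 < c := α.blocks_pos c (by simp [hα])
  induction b, hab using Nat.le_induction with
  | base =>
    obtain ⟨p, x, hp⟩ := (nearPow α a).exists_blocks_eq_concat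
    obtain ⟨a, rfl⟩ := Nat.exists_eq_add_of_lt ha
    simp only [Nat.zero_add] at *
    exact ⟨p, x, x + c, q, hp, blocks_near hp hα, by omega⟩
  | succ b hb ih =>
    obtain ⟨p, x, y, z, h1, h2, h3⟩ := ih
    obtain ⟨b, rfl⟩ : ∃ k, b = k + 1 := ⟨b - 1, by omega⟩
    -- The next gluing enlarges `y` itself if nothing follows it, and a later component otherwise.
    rcases List.eq_nil_or_concat z with rfl | ⟨z, w, rfl⟩
    · exact ⟨p, x, y + c, q, h1, blocks_near h2 hα, by omega⟩
    · refine ⟨p, x, y, z ++ (w + c) :: q, h1, ?_, h3⟩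
      rw [nearPow, blocks_near (p := p ++ y :: z) (x := w) (by simp [h2]) hα]
      simp

theorem circ_lt_circ_of_left {α β : Comp} (γ : Comp) (hl : α.length = β.length)
    (h : α.blocks < β.blocks) : (circ α γ).blocks < (circ β γ).blocks := by
  obtain ⟨p, a, b, x, y, h1, h2, hab⟩ := exists_of_lt hl h
  have ha : 0 < a := α.blocks_pos a (by simp [h1])
  obtain ⟨q, u, v, z, h3, h4, huv⟩ := nearPow_blocks_of_lt γ ha hab
  simp only [circ, blocks_ofBlocks, h1, h2, List.flatMap_append, List.flatMap_cons, h3, h4]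
  simpa using append_cons_lt_append_cons ((p.flatMap fun a => (nearPow γ a).blocks) ++ q) _ _ huv

/-- Within the first copy of `α`, gluing changes only the last component. -/
theorem nearPow_blocks_prefix {α : Comp} {p x : List ℕ} (hx : x ≠ [])
    (h : α.blocks = p ++ x) (n : ℕ) : ∃ y, y ≠ [] ∧ (nearPow α n).blocks = p ++ x.dropLast ++ y := by
  have h0 : α.blocks = p ++ x.dropLast ++ [x.getLast hx] := by
    rw [h, List.append_assoc, List.dropLast_append_getLast]
  obtain ⟨c, q, hα⟩ := α.exists_blocks_eq_cons
  induction n using nearPow.induct with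
  | case1 => exact ⟨_, by simp, h0⟩
  | case2 => exact ⟨_, by simp, h0⟩
  | case3 n ih =>
    obtain ⟨y, hy, e⟩ := ih
    refine ⟨y.dropLast ++ (y.getLast hy + c) :: q, by simp, ?_⟩
    rw [nearPow, blocks_near (p := p ++ x.dropLast ++ y.dropLast) (x := y.getLast hy) _ hα]
    · simp
    · rw [e, List.append_assoc _ y.dropLast, List.dropLast_append_getLast]

theorem circ_blocks_prefix (β : Comp) {α : Comp} {p x : List ℕ} {a : ℕ} (hx : x ≠ [])
    (h : α.blocks = p ++ a :: x) : ∃ y, (circ β α).blocks = p ++ a :: y := by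
  obtain ⟨b, l, hb⟩ := β.exists_blocks_eq_cons
  obtain ⟨y, -, hy⟩ := nearPow_blocks_prefix (p := p ++ [a]) hx (by simpa using h) b
  exact ⟨x.dropLast ++ y ++ l.flatMap fun a => (nearPow α a).blocks, by simp [circ, hb, hy]⟩

theorem circ_lt_circ_of_right (β β' : Comp) {γ δ : Comp} (hl : γ.length = δ.length)
    (hs : γ.size = δ.size) (h : γ.blocks < δ.blocks) :
    (circ β γ).blocks < (circ β' δ).blocks := by
  obtain ⟨p, a, b, x, y, h1, h2, hab⟩ := exists_of_lt hl h
  have hxy : x.length = y.length := by simpa [length, h1, h2] using hl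
  -- A first difference in the last component would make the sums differ.
  have hx : x ≠ [] := by
    rintro rfl
    obtain rfl := List.length_eq_zero_iff.1 hxy.symm
    rw [← blocks_sum, ← blocks_sum, h1, h2] at hs
    simp at hs
    omega
  have hy : y ≠ [] := by
    rintro rfl
    exact hx (List.length_eq_zero_iff.1 hxy)
  obtain ⟨u, hu⟩ := circ_blocks_prefix β hx h1
  obtain ⟨v, hv⟩ := circ_blocks_prefix β' hy h2
  rw [hu, hv]
  exact append_cons_lt_append_cons p u v hab

@[simp]
theorem length_reversal (α : Comp) : α.reversal.length = α.length := by simp [length]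

theorem lt_or_gt_of_not_isSymmetric {α : Comp} (h : ¬ α.IsSymmetric) :
    α.blocks < α.reversal.blocks ∨ α.reversal.blocks < α.blocks :=
  lt_or_gt_of_ne fun e => h (Comp.ext e)

theorem lexLT_reversal_circ_of_right (α : Comp) {β : Comp} (h : ¬ β.IsSymmetric) :
    LexLT (circ α β) (circ α β).reversal ↔ LexLT β β.reversal := by
  rw [lexLT_iff (by simp), lexLT_iff (by simp), reversal_circ]
  -- The opposite inequality for `β` would carry over to the products as well.
  refine ⟨fun h1 => (lt_or_gt_of_not_isSymmetric h).resolve_right fun h2 => ?_,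
    circ_lt_circ_of_right _ _ (by simp) rfl⟩
  exact lt_asymm h1 (circ_lt_circ_of_right _ _ (by simp) rfl h2)

theorem lexLT_reversal_circ_of_left {α β : Comp} (h : ¬ α.IsSymmetric) (hβ : β.IsSymmetric) :
    LexLT (circ α β) (circ α β).reversal ↔ LexLT α α.reversal := by
  rw [lexLT_iff (by simp), lexLT_iff (by simp), reversal_circ, ← hβ]
  refine ⟨fun h1 => (lt_or_gt_of_not_isSymmetric h).resolve_right fun h2 => ?_,
    circ_lt_circ_of_left _ (by simp)⟩
  exact lt_asymm h1 (circ_lt_circ_of_left _ (by simp) h2)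

theorem isSymmetric_circ_iff (α β : Comp) :
    (circ α β).IsSymmetric ↔ α.IsSymmetric ∧ β.IsSymmetric := by
  refine ⟨fun h => ?_, fun ⟨hα, hβ⟩ => by rw [IsSymmetric, reversal_circ, ← hα, ← hβ]⟩
  have e : (circ α β).blocks = (circ α.reversal β.reversal).blocks := by
    rw [← reversal_circ, ← h]
  have hβ : β.IsSymmetric := by
    by_contra hβ
    rcases lt_or_gt_of_not_isSymmetric hβ with h' | h'
    · exact (circ_lt_circ_of_right α α.reversal β.length_reversal.symm rfl h').ne e
    · exact (circ_lt_circ_of_right α.reversal α β.length_reversal rfl h').ne e.symm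
  refine ⟨?_, hβ⟩
  by_contra hα
  rw [← hβ] at e
  rcases lt_or_gt_of_not_isSymmetric hα with h' | h'
  · exact (circ_lt_circ_of_left β (by simp) h').ne e
  · exact (circ_lt_circ_of_left β (by simp) h').ne e.symm

theorem isSymmetric_circList_iff (L : List Comp) :
    (circList L).IsSymmetric ↔ ∀ β ∈ L, β.IsSymmetric := by
  induction L using circList.induct with
  | case1 => exact ⟨fun _ => by simp, fun _ => rfl⟩
  | case2 α => simp [circList]
  | case3 α β L ih => rw [circList, isSymmetric_circ_iff, ih, List.forall_mem_cons (a := α)]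

/-- Each factor of `K` can be stripped because what stands to its right contains `β` and so is
asymmetric; the remaining product of `M` is symmetric, so `β` decides. -/
theorem lexLT_reversal_circList_append (K M : List Comp) {β : Comp} (hβ : ¬ β.IsSymmetric)
    (hM : ∀ γ ∈ M, γ.IsSymmetric) :
    LexLT (circList (K ++ β :: M)) (circList (K ++ β :: M)).reversal ↔
      LexLT β β.reversal := by
  induction K with
  | nil =>
    cases M with
    | nil => rfl
    | cons γ M =>
      exact lexLT_reversal_circ_of_left hβ ((isSymmetric_circList_iff _).2 hM)
  | cons δ K ih =>
    obtain ⟨ε, N, hN⟩ : ∃ ε N, K ++ β :: M = ε :: N :=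
      List.exists_cons_of_ne_nil (by simp)
    have hns : ¬ (circList (K ++ β :: M)).IsSymmetric := fun h =>
      hβ ((isSymmetric_circList_iff _).1 h β (by simp))
    rw [List.cons_append, ← ih]
    rw [hN] at hns ⊢
    exact lexLT_reversal_circ_of_right δ hns

end Comp

theorem mainTheorem4 (α : Comp) (L : List Comp) (hL : Comp.IsIrreducibleFactorisation α L) :
    (α.IsSymmetric ↔ ∀ i : Fin L.length, (L.get i).IsSymmetric) ∧
    (¬ α.IsSymmetric →
      (∃ l : Fin L.length, ¬ (L.get l).IsSymmetric ∧
        ∀ i : Fin L.length, l < i → (L.get i).IsSymmetric) ∧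
      (∀ l : Fin L.length, ¬ (L.get l).IsSymmetric →
        (∀ i : Fin L.length, l < i → (L.get i).IsSymmetric) →
        (Comp.LexLT α α.reversal ↔ Comp.LexLT (L.get l) (L.get l).reversal))) := by
  have hsymm : α.IsSymmetric ↔ ∀ i : Fin L.length, (L.get i).IsSymmetric := by
    rw [hL.eq_circList, Comp.isSymmetric_circList_iff, List.forall_mem_iff_get]
  refine ⟨hsymm, fun hα => ⟨?_, fun l hl hgt => ?_⟩⟩
  · rw [hsymm, not_forall] at hα
    obtain ⟨i, hi⟩ := hα
    obtain ⟨l, hl, hmax⟩ := (Set.toFinite {i : Fin L.length | ¬ (L.get i).IsSymmetric}).exists_maximal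
      ⟨i, hi⟩
    exact ⟨l, hl, fun j hj => by_contra fun hj' => (hmax hj' hj.le).not_gt hj⟩
  · have hsplit : L = L.take l ++ L.get l :: L.drop (l + 1) := by simp
    rw [hL.eq_circList]
    conv_lhs => rw [hsplit]
    refine Comp.lexLT_reversal_circList_append _ _ hl fun γ hγ => ?_
    obtain ⟨j, hj, rfl⟩ := List.mem_iff_getElem.1 hγ
    rw [List.length_drop] at hj
    rw [List.getElem_drop]
    exact hgt ⟨l + 1 + j, by omega⟩ (Fin.lt_def.2 (by simp only; omega))
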